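/- **Theorem 2.** For $\sigma\in\mathfrak S_n$, the symmetric group on $\{1,\dots,n\}$, let $\hat d(\sigma)$ be the number of $i\in\{1,\dots,n-1\}$ such that either $i$ is odd and $\sigma(i)>\sigma(i+1)$, or $i$ is even and $\sigma(i)<\sigma(i+1)$, and put $\hat A_n(x)=\sum_{\sigma\in\mathfrak S_n}x^{\hat d(\sigma)}$. Let $\mathcal B_n$ be the set of permutations $\sigma$ of $\{\pm1,\dots,\pm n\}$ with $\sigma(-i)=-\sigma(i)$ for all $i$. For $\sigma\in\mathcal B_n$ put $\sigma(0)=0$, let $\hat d_B(\sigma)$ be the number of $i\in\{0,1,\dots,n-1\}$ such that either $i$ is even and $\sigma(i)<\sigma(i+1)$, or $i$ is odd and $\sigma(i)>\sigma(i+1)$, and put $\hat B_n(x)=\sum_{\sigma\in\mathcal B_n}x^{\hat d_B(\sigma)}$. Let $P_n$ and $Q_n$ be the derivative polynomials of tangent and secant, that is, the unique real polynomials with $$\frac{d^n}{d\theta^n}\tan\theta=P_n(\tan\theta),\qquad \frac{d^n}{d\theta^n}\sec\theta=Q_n(\tan\theta)\sec\theta$$ for all real $\theta$ with $\cos\theta\neq0$.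 Then, as identities in the field $\mathbb R(x)$ of rational functions, $$2^n(1+x^2)\hat A_n(x)=(1-x)^{n+1}P_n\!\left(\frac{1+x}{1-x}\right)\quad\text{for all } n\ge1,$$ $$\hat B_n(x)=(1-x)^{n}Q_n\!\left(\frac{1+x}{1-x}\right)\quad\text{for all } n\ge0.$$ -/

import Mathlib

open Polynomial

namespace AltDescent

/-- The letter `σ(i)` (for `1 ≤ i ≤ n`) of the one-line notation `σ(1)⋯σ(n)`, with letters
`1, …, n`; here `Fin n = {0, …, n - 1}` is shifted by one. The value outside `1 ≤ i ≤ n`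
is never used. -/
def letter {n : ℕ} (σ : Equiv.Perm (Fin n)) (i : ℕ) : ℕ :=
  if h : 1 ≤ i ∧ i ≤ n then (σ ⟨i - 1, by omega⟩ : ℕ) + 1 else 0

/-- The set of alternating descent positions `i`, `1 ≤ i ≤ n - 1`, of a permutation. -/
def altDescents {n : ℕ} (σ : Equiv.Perm (Fin n)) : Finset ℕ :=
  {i ∈ Finset.Ico 1 n |
    (Odd i ∧ letter σ i > letter σ (i + 1)) ∨ (Even i ∧ letter σ i < letter σ (i + 1))}

/-- The alternating Eulerian polynomial of type A. -/
noncomputable def altEulerianA (n : ℕ) : ℝ[X] :=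
  ∑ σ : Equiv.Perm (Fin n), X ^ (altDescents σ).card

/-- The set `[±n] = {1, …, n} ∪ {-1, …, -n}`. -/
noncomputable def plusMinus (n : ℕ) : Finset ℤ := (Finset.Icc (-(n : ℤ)) n).erase 0

/-- Permutations of type B: permutations `σ` of `[±n]` such that `σ(-i) = -σ(i)`. -/
abbrev SignedPerm (n : ℕ) : Type :=
  {σ : Equiv.Perm (plusMinus n) // ∀ i j : plusMinus n, (j : ℤ) = -i → (σ j : ℤ) = -(σ i : ℤ)}

/-- The letter `σ(i)` (for `0 ≤ i ≤ n`) of the word `σ(0)σ(1)⋯σ(n)`, where `σ(0) = 0`. The value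
for `i > n` is never used. -/
noncomputable def signedLetter {n : ℕ} (σ : SignedPerm n) (i : ℕ) : ℤ :=
  if h : (i : ℤ) ∈ plusMinus n then (σ.1 ⟨i, h⟩ : ℤ) else 0

/-- The set of alternating descent positions `i`, `0 ≤ i ≤ n - 1`, of a type B permutation. -/
noncomputable def altDescentsB {n : ℕ} (σ : SignedPerm n) : Finset ℕ :=
  {i ∈ Finset.range n |
    (Even i ∧ signedLetter σ i < signedLetter σ (i + 1)) ∨
      (Odd i ∧ signedLetter σ i > signedLetter σ (i + 1))}

/-- The alternating Eulerian polynomial of type B. -/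
noncomputable def altEulerianB (n : ℕ) : ℝ[X] :=
  ∑ σ : SignedPerm n, X ^ (altDescentsB σ).card

/-- `P` satisfies `dⁿ/dxⁿ tan x = P(tan x)` wherever the tangent is defined. -/
def IsTanDerivPoly (n : ℕ) (P : ℝ[X]) : Prop :=
  ∀ x : ℝ, Real.cos x ≠ 0 → iteratedDeriv n Real.tan x = P.eval (Real.tan x)

/-- `Q` satisfies `dⁿ/dxⁿ sec x = Q(tan x) sec x` wherever the secant is defined. -/
def IsSecDerivPoly (n : ℕ) (Q : ℝ[X]) : Prop :=
  ∀ x : ℝ, Real.cos x ≠ 0 →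
    iteratedDeriv n (fun y => (Real.cos y)⁻¹) x = Q.eval (Real.tan x) * (Real.cos x)⁻¹

theorem eventually_cos_ne {x : ℝ} (hx : Real.cos x ≠ 0) :
    ∀ᶠ y in nhds x, Real.cos y ≠ 0 :=
  Real.continuous_cos.continuousAt.eventually_ne hx

theorem hasDerivAt_tan_sq {x : ℝ} (hx : Real.cos x ≠ 0) :
    HasDerivAt Real.tan (1 + Real.tan x ^ 2) x := by
  have h := Real.hasDerivAt_tan hx
  have e : 1 / Real.cos x ^ 2 = 1 + Real.tan x ^ 2 := by
    rw [Real.tan_eq_sin_div_cos]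
    field_simp
    linarith [Real.sin_sq_add_cos_sq x]
  rwa [e] at h

theorem hasDerivAt_sec {x : ℝ} (hx : Real.cos x ≠ 0) :
    HasDerivAt (fun y => (Real.cos y)⁻¹) (Real.tan x * (Real.cos x)⁻¹) x := by
  have h := (Real.hasDerivAt_cos x).inv hx
  have e : -(-Real.sin x) / Real.cos x ^ 2 = Real.tan x * (Real.cos x)⁻¹ := by
    rw [Real.tan_eq_sin_div_cos]
    field_simp
    try ring
  rw [e] at h
  exact h

theorem IsTanDerivPoly.succ {n : ℕ} {P : ℝ[X]} (h : IsTanDerivPoly n P) :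
    IsTanDerivPoly (n + 1) ((1 + X ^ 2) * derivative P) := by
  intro x hx
  have h1 : iteratedDeriv n Real.tan =ᶠ[nhds x] fun y => P.eval (Real.tan y) := by
    filter_upwards [eventually_cos_ne hx] with y hy using h y hy
  have h2 : HasDerivAt (fun y => P.eval (Real.tan y)) _ x :=
    (P.hasDerivAt (Real.tan x)).comp x (hasDerivAt_tan_sq hx)
  rw [iteratedDeriv_succ, h1.deriv_eq, h2.deriv]
  simp
  ring

theorem IsSecDerivPoly.succ {n : ℕ} {Q : ℝ[X]} (h : IsSecDerivPoly n Q) :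
    IsSecDerivPoly (n + 1) (X * Q + (1 + X ^ 2) * derivative Q) := by
  intro x hx
  have h1 : iteratedDeriv n (fun y => (Real.cos y)⁻¹) =ᶠ[nhds x]
      fun y => Q.eval (Real.tan y) * (Real.cos y)⁻¹ := by
    filter_upwards [eventually_cos_ne hx] with y hy using h y hy
  have h2 : HasDerivAt (fun y => Q.eval (Real.tan y)) _ x :=
    (Q.hasDerivAt (Real.tan x)).comp x (hasDerivAt_tan_sq hx)
  have h3 : HasDerivAt (fun y => Q.eval (Real.tan y) * (Real.cos y)⁻¹) _ x :=
    h2.mul (hasDerivAt_sec hx)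
  rw [iteratedDeriv_succ, h1.deriv_eq, h3.deriv]
  simp
  ring

theorem existsUnique_tanDerivPoly (n : ℕ) : ∃! P : ℝ[X], IsTanDerivPoly n P := by
  refine existsUnique_of_exists_of_unique ?_ ?_
  · induction n with
    | zero => exact ⟨X, fun x _ => by simp⟩
    | succ n ih => exact ih.elim fun P hP => ⟨_, hP.succ⟩
  · intro P₁ P₂ h₁ h₂
    refine Polynomial.funext fun r => ?_
    have := (h₁ _ (Real.cos_arctan_pos r).ne').symm.trans (h₂ _ (Real.cos_arctan_pos r).ne')
    rwa [Real.tan_arctan] at this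

theorem existsUnique_secDerivPoly (n : ℕ) : ∃! Q : ℝ[X], IsSecDerivPoly n Q := by
  refine existsUnique_of_exists_of_unique ?_ ?_
  · induction n with
    | zero => exact ⟨1, fun x _ => by simp⟩
    | succ n ih => exact ih.elim fun Q hQ => ⟨_, hQ.succ⟩
  · intro Q₁ Q₂ h₁ h₂
    refine Polynomial.funext fun r => ?_
    have hc := (Real.cos_arctan_pos r).ne'
    have := (h₁ _ hc).symm.trans (h₂ _ hc)
    rw [Real.tan_arctan] at this
    exact mul_right_cancel₀ (inv_ne_zero hc) this

/-- The derivative polynomial `P_n` of the tangent: the unique real polynomial with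
`dⁿ/dxⁿ tan x = P_n(tan x)`. -/
noncomputable def tanDerivPoly (n : ℕ) : ℝ[X] := (existsUnique_tanDerivPoly n).choose

/-- The derivative polynomial `Q_n` of the secant: the unique real polynomial with
`dⁿ/dxⁿ sec x = Q_n(tan x) sec x`. -/
noncomputable def secDerivPoly (n : ℕ) : ℝ[X] := (existsUnique_secDerivPoly n).choose

end AltDescent

/-!
Write a signed permutation as a word `w` of length `n`, insert `n + 1` or `-(n + 1)` after `j` of
its letters and negate all letters that follow. Negation reverses comparisons and the insertion
shifts positions by one, so the alternating descents after the gap survive. An interior gap is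
replaced by two new pairs, and one of the two signs makes both of them alternating descents, the
other neither: if `w` has `d` alternating descents, each of the `d` gaps carrying one contributes
`X ^ (d - 1) + X ^ (d + 1)`, and each of the others `X ^ d + X ^ (d + 2)`. A gap at an end of the
word contributes `X ^ d + X ^ (d + 1)`. Summing over `w` gives differential recurrences for the
generating polynomials of the signed words. In type B (words preceded by `0`) these polynomials
are the `altEulerianB n`; without the leading `0` they are `2 ^ n * altEulerianA n`, because each
of the `2 ^ n` choices of the negated values gives one copy of the symmetric group.

On the other side, put `t = (1 + x) / (1 - x)` and let `D` be the derivation of `ℝ(x)` with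
`D x = 1`. Then `(1 + x ^ 2) * D t = 1 + t ^ 2`, so that `D` turns the recurrences
`P (n + 1) = (1 + X ^ 2) * derivative (P n)` and
`Q (n + 1) = X * Q n + (1 + X ^ 2) * derivative (Q n)`, evaluated at `t`, into the recurrences of
the Eulerian polynomials.
-/

namespace AltDescent

section Words

variable {α β : Type*} [LinearOrder α] [LinearOrder β]

/-- The number of alternating descents of a word: a pair of consecutive letters is counted
alternately when it is a descent and when it is an ascent. The flag tells whether the first pair is
counted when it is a descent (`true`) or when it is an ascent (`false`). -/
def altDesc : Bool → List α → ℕ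
  | b, x :: y :: l => (if (if b then y < x else x < y) then 1 else 0) + altDesc (!b) (y :: l)
  | _, _ => 0

theorem altDesc_cons_cons (b : Bool) (x y : α) (l : List α) :
    altDesc b (x :: y :: l) =
      (if (if b then y < x else x < y) then 1 else 0) + altDesc (!b) (y :: l) := rfl

@[simp] theorem altDesc_singleton (b : Bool) (x : α) : altDesc b [x] = 0 := by simp [altDesc]

theorem altDesc_cons_cons_of_lt {x y : α} (h : x < y) (b : Bool) (l : List α) :
    altDesc b (x :: y :: l) = (!b).toNat + altDesc (!b) (y :: l) := by
  cases b <;> simp [altDesc_cons_cons, h, h.not_gt]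

theorem altDesc_cons_cons_of_gt {x y : α} (h : y < x) (b : Bool) (l : List α) :
    altDesc b (x :: y :: l) = b.toNat + altDesc (!b) (y :: l) := by
  cases b <;> simp [altDesc_cons_cons, h, h.not_gt]

theorem altDesc_map_of_strictMono {e : α → β} (he : StrictMono e) (b : Bool) :
    ∀ l : List α, altDesc b (l.map e) = altDesc b l
  | [] => rfl
  | [_] => by simp
  | x :: y :: l => by
    have ih := altDesc_map_of_strictMono he (!b) (y :: l)
    simp only [List.map_cons, altDesc_cons_cons, he.lt_iff_lt] at ih ⊢
    rw [ih]

theorem altDesc_map_of_strictAnti {e : α → β} (he : StrictAnti e) (b : Bool) :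
    ∀ l : List α, altDesc b (l.map e) = altDesc (!b) l
  | [] => by cases b <;> rfl
  | [_] => by simp
  | x :: y :: l => by
    have ih := altDesc_map_of_strictAnti he (!b) (y :: l)
    simp only [List.map_cons, altDesc_cons_cons, he.lt_iff_gt] at ih ⊢
    rw [ih]
    cases b <;> rfl

theorem altDesc_map_range (b : Bool) (g : ℕ → α) (n : ℕ) :
    altDesc b ((List.range (n + 1)).map g) =
      Finset.card {i ∈ Finset.range n |
        if Even i ↔ b = true then g (i + 1) < g i else g i < g (i + 1)} := by
  rw [Finset.card_filter]
  induction n generalizing b g with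
  | zero => simp
  | succ n ih =>
    have hsplit : (List.range (n + 2)).map g =
        g 0 :: g 1 :: (List.range n).map fun i => g (i + 1 + 1) := by
      simp [List.range_succ_eq_map, Function.comp_def]
    have htail : (List.range (n + 1)).map (fun i => g (i + 1)) =
        g 1 :: (List.range n).map fun i => g (i + 1 + 1) := by
      simp [List.range_succ_eq_map, Function.comp_def]
    rw [hsplit, altDesc_cons_cons, ← htail, ih, Finset.sum_range_succ', add_comm]
    congr 1
    · refine Finset.sum_congr rfl fun i _ => ?_
      by_cases hi : Even i <;> cases b <;> simp [hi, Nat.even_add_one]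
    · simp

end Words

section Insertion

/-- The word obtained from `w` by inserting the letter `a` after the first `j` letters and negating
all the letters that follow it. -/
def insertNeg {α : Type*} [Neg α] (a : α) (w : List α) (j : ℕ) : List α :=
  w.take j ++ a :: (w.drop j).map Neg.neg

theorem insertNeg_cons_zero {α : Type*} [Neg α] (a x : α) (w : List α) :
    insertNeg a (x :: w) 0 = a :: -x :: w.map Neg.neg := rfl

theorem insertNeg_cons_succ {α : Type*} [Neg α] (a x : α) (w : List α) (j : ℕ) :
    insertNeg a (x :: w) (j + 1) = x :: insertNeg a w j := rfl

theorem insertNeg_inj {α : Type*} [InvolutiveNeg α] {a a' : α} {w w' : List α} {j j' : ℕ}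
    (ha' : a' ∉ w) (hna' : -a' ∉ w) (hj : j ≤ w.length) (hj' : j' ≤ w'.length) :
    insertNeg a w j = insertNeg a' w' j' ↔ a = a' ∧ w = w' ∧ j = j' := by
  refine ⟨fun h => ?_, by rintro ⟨rfl, rfl, rfl⟩; rfl⟩
  have hdrop : a' ∉ (w.drop j).map Neg.neg := by
    rintro hmem
    obtain ⟨y, hy, rfl⟩ := List.mem_map.1 hmem
    exact hna' (by simpa using List.mem_of_mem_drop hy)
  obtain ⟨htake, ha, hneg⟩ :=
    (List.append_cons_inj_of_notMem (fun hmem => ha' (List.mem_of_mem_take hmem)) hdrop).1 h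
  have hdrop_eq := List.map_injective_iff.2 neg_injective hneg
  refine ⟨ha, ?_, by simpa [hj, hj'] using congrArg List.length htake⟩
  rw [← List.take_append_drop j w, htake, hdrop_eq, List.take_append_drop]

variable {R : Type*} [CommRing R]
  {α : Type*} [AddCommGroup α] [LinearOrder α] [IsOrderedAddMonoid α] {m x y : α}

theorem altDesc_cons_map_neg (b : Bool) (x : α) (w : List α) :
    altDesc b (-x :: w.map Neg.neg) = altDesc (!b) (x :: w) :=
  altDesc_map_of_strictAnti (fun _ _ h => neg_lt_neg h) b (x :: w)

theorem pow_altDesc_insertNeg_zero (hy : |y| < m) (b : Bool) (w : List α) :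
    (X : R[X]) ^ altDesc b (insertNeg m (y :: w) 0) + X ^ altDesc b (insertNeg (-m) (y :: w) 0) =
      (1 + X) * X ^ altDesc b (y :: w) := by
  obtain ⟨hmy, hym⟩ := abs_lt.1 hy
  rw [insertNeg_cons_zero, insertNeg_cons_zero, altDesc_cons_cons_of_gt (neg_lt.1 hmy),
    altDesc_cons_cons_of_lt (neg_lt_neg hym), altDesc_cons_map_neg, Bool.not_not]
  cases b <;> simp only [Bool.not_false, Bool.not_true, Bool.toNat_true, Bool.toNat_false] <;> ring

-- One of the letters `m`, `-m` makes both new pairs alternating descents, the other one neither.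
theorem pow_altDesc_cons_insertNeg_zero (hx : |x| < m) (hy : |y| < m) (b : Bool) (w : List α) :
    (X : R[X]) ^ altDesc b (x :: insertNeg m (y :: w) 0) +
        X ^ altDesc b (x :: insertNeg (-m) (y :: w) 0) =
      (1 + X ^ 2) * X ^ altDesc (!b) (y :: w) := by
  obtain ⟨hmx, hxm⟩ := abs_lt.1 hx
  obtain ⟨hmy, hym⟩ := abs_lt.1 hy
  rw [insertNeg_cons_zero, insertNeg_cons_zero, altDesc_cons_cons_of_lt hxm,
    altDesc_cons_cons_of_gt (neg_lt.1 hmy), altDesc_cons_cons_of_gt hmx,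
    altDesc_cons_cons_of_lt (neg_lt_neg hym), altDesc_cons_map_neg, Bool.not_not]
  cases b <;> simp only [Bool.not_false, Bool.not_true, Bool.toNat_true, Bool.toNat_false] <;> ring

theorem sum_pow_altDesc_cons_insertNeg (b : Bool) (hx : |x| < m) {w : List α}
    (hw : ∀ y ∈ w, |y| < m) :
    ∑ j ∈ Finset.range (w.length + 1),
      ((X : R[X]) ^ altDesc b (x :: insertNeg m w j) + X ^ altDesc b (x :: insertNeg (-m) w j)) =
    (1 + X + (w.length : R[X]) * (1 + X ^ 2)) * X ^ altDesc b (x :: w) +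
      (1 - X) * (1 + X ^ 2) * derivative (X ^ altDesc b (x :: w)) := by
  induction w generalizing b x with
  | nil =>
    obtain ⟨hmx, hxm⟩ := abs_lt.1 hx
    simp only [insertNeg, List.take_nil, List.drop_nil, List.map_nil, List.nil_append]
    cases b <;> simp [altDesc_cons_cons_of_lt hxm, altDesc_cons_cons_of_gt hmx, add_comm]
  | cons y w ih =>
    obtain ⟨hy, hw⟩ := List.forall_mem_cons.1 hw
    have ih := ih (!b) hy hw
    rw [List.length_cons, Finset.sum_range_succ', pow_altDesc_cons_insertNeg_zero hx hy]
    simp only [insertNeg_cons_succ, altDesc_cons_cons, pow_add, ← mul_add, ← Finset.mul_sum, ih]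
    split_ifs <;>
      simp only [derivative_mul, derivative_X, pow_one, pow_zero, derivative_one] <;>
      push_cast <;> ring

theorem sum_pow_altDesc_insertNeg (b : Bool) {w : List α} (hw : ∀ y ∈ w, |y| < m) (hne : w ≠ []) :
    ∑ j ∈ Finset.range (w.length + 1),
      ((X : R[X]) ^ altDesc b (insertNeg m w j) + X ^ altDesc b (insertNeg (-m) w j)) =
    (2 * (1 + X) + ((w.length : R[X]) - 1) * (1 + X ^ 2)) * X ^ altDesc b w +
      (1 - X) * (1 + X ^ 2) * derivative (X ^ altDesc b w) := by
  obtain ⟨x, w, rfl⟩ := List.exists_cons_of_ne_nil hne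
  obtain ⟨hx, hw⟩ := List.forall_mem_cons.1 hw
  rw [List.length_cons, Finset.sum_range_succ', pow_altDesc_insertNeg_zero hx]
  simp only [insertNeg_cons_succ]
  rw [sum_pow_altDesc_cons_insertNeg b hx hw]
  push_cast
  ring

end Insertion

section SignedWords

theorem map_natAbs_insertNeg (a : ℤ) (w : List ℤ) (j : ℕ) :
    (insertNeg a w j : Multiset ℤ).map Int.natAbs =
      a.natAbs ::ₘ (w : Multiset ℤ).map Int.natAbs := by
  have hneg : Int.natAbs ∘ Neg.neg = Int.natAbs := funext Int.natAbs_neg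
  rw [Multiset.map_coe, Multiset.map_coe, Multiset.cons_coe, Multiset.coe_eq_coe, insertNeg,
    List.map_append, List.map_cons, List.map_map, hneg]
  refine List.perm_middle.trans (List.Perm.cons _ ?_)
  rw [← List.map_append, List.take_append_drop]

theorem exists_insertNeg_eq {α : Type*} [InvolutiveNeg α] {a : α} {w : List α} (h : a ∈ w) :
    ∃ v j, j ≤ v.length ∧ insertNeg a v j = w := by
  obtain ⟨s, t, rfl⟩ := List.append_of_mem h
  refine ⟨s ++ t.map Neg.neg, s.length, by simp, ?_⟩
  simp [insertNeg]

/-- A signed word of length `n`, that is, the one-line notation of a signed permutation: a word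
whose letters have the absolute values `1, …, n`, each of them once. -/
def IsSignedWord (n : ℕ) (w : List ℤ) : Prop :=
  (w : Multiset ℤ).map Int.natAbs = (Finset.Icc 1 n).val

namespace IsSignedWord

variable {n : ℕ} {w : List ℤ}

theorem length_eq (h : IsSignedWord n w) : w.length = n := by
  simpa using congrArg Multiset.card h

theorem nodup_map_natAbs (h : IsSignedWord n w) : (w.map Int.natAbs).Nodup := by
  rw [← Multiset.coe_nodup, ← Multiset.map_coe, h]
  exact (Finset.Icc 1 n).nodup

theorem natAbs_mem_Icc (h : IsSignedWord n w) {y : ℤ} (hy : y ∈ w) :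
    y.natAbs ∈ Finset.Icc 1 n := by
  rw [← Finset.mem_val, ← h]
  exact Multiset.mem_map_of_mem _ hy

theorem abs_lt (h : IsSignedWord n w) {y : ℤ} (hy : y ∈ w) : |y| < n + 1 := by
  have := (Finset.mem_Icc.1 (h.natAbs_mem_Icc hy)).2
  rw [Int.abs_eq_natAbs]
  omega

theorem notMem (h : IsSignedWord n w) {a : ℤ} (ha : a.natAbs = n + 1) : a ∉ w := fun hmem => by
  have := (Finset.mem_Icc.1 (h.natAbs_mem_Icc hmem)).2
  omega

theorem exists_natAbs_eq (h : IsSignedWord n w) {v : ℕ} (hv : v ∈ Finset.Icc 1 n) :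
    ∃ y ∈ w, y.natAbs = v := by
  rw [← Finset.mem_val, ← h] at hv
  simpa using hv

theorem of_forall_exists_natAbs_eq (hlen : w.length = n)
    (hmem : ∀ v ∈ Finset.Icc 1 n, ∃ y ∈ w, y.natAbs = v) : IsSignedWord n w := by
  refine (Multiset.eq_of_le_of_card_le (Finset.val_le_iff_val_subset.2 fun v hv => ?_) ?_).symm
  · simpa using hmem v hv
  · simp [hlen]

end IsSignedWord

theorem isSignedWord_zero_iff {w : List ℤ} : IsSignedWord 0 w ↔ w = [] := by
  simp [IsSignedWord]

theorem isSignedWord_insertNeg_iff {n : ℕ} {a : ℤ} (ha : a.natAbs = n + 1) (w : List ℤ) (j : ℕ) :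
    IsSignedWord (n + 1) (insertNeg a w j) ↔ IsSignedWord n w := by
  have hIcc : (Finset.Icc 1 (n + 1)).val = (n + 1) ::ₘ (Finset.Icc 1 n).val := by
    rw [← Finset.insert_Icc_right_eq_Icc_add_one (by omega), Finset.insert_val_of_notMem (by simp)]
  rw [IsSignedWord, map_natAbs_insertNeg, hIcc, ha, Multiset.cons_inj_right, IsSignedWord]

/-- The finite set of signed words of length `n`, generated by inserting `n` or `-n` with
`insertNeg` in all possible ways into the signed words of length `n - 1`. -/
def signedWords : ℕ → Finset (List ℤ)
  | 0 => {[]}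
  | n + 1 => ((signedWords n ×ˢ Finset.range (n + 1)) ×ˢ {(n + 1 : ℤ), -(n + 1 : ℤ)}).image
      fun p => insertNeg p.2 p.1.1 p.1.2

theorem mem_pair_neg_iff {n : ℕ} {a : ℤ} :
    a ∈ ({(n + 1 : ℤ), -(n + 1 : ℤ)} : Finset ℤ) ↔ a.natAbs = n + 1 := by
  rw [Finset.mem_insert, Finset.mem_singleton]
  omega

theorem mem_signedWords {n : ℕ} {w : List ℤ} : w ∈ signedWords n ↔ IsSignedWord n w := by
  induction n generalizing w with
  | zero => rw [signedWords, Finset.mem_singleton, isSignedWord_zero_iff]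
  | succ n ih =>
    simp only [signedWords, Finset.mem_image, Finset.mem_product, Finset.mem_range, Prod.exists,
      mem_pair_neg_iff, ih]
    constructor
    · rintro ⟨v, j, a, ⟨⟨hv, -⟩, ha⟩, rfl⟩
      exact (isSignedWord_insertNeg_iff ha v j).2 hv
    · intro hw
      obtain ⟨a, haw, ha⟩ := hw.exists_natAbs_eq (Finset.right_mem_Icc.2 (by omega))
      obtain ⟨v, j, hj, rfl⟩ := exists_insertNeg_eq haw
      have hv := (isSignedWord_insertNeg_iff ha v j).1 hw
      exact ⟨v, j, a, ⟨⟨hv, Nat.lt_succ_of_le (hj.trans_eq hv.length_eq)⟩, ha⟩, rfl⟩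

theorem sum_signedWords_succ {M : Type*} [AddCommMonoid M] (n : ℕ) (f : List ℤ → M) :
    ∑ w ∈ signedWords (n + 1), f w =
      ∑ w ∈ signedWords n, ∑ j ∈ Finset.range (n + 1),
        (f (insertNeg (n + 1) w j) + f (insertNeg (-(n + 1)) w j)) := by
  rw [signedWords, Finset.sum_image, Finset.sum_product, Finset.sum_product]
  · refine Finset.sum_congr rfl fun w _ => Finset.sum_congr rfl fun j _ => ?_
    exact Finset.sum_pair (by omega)
  · rintro ⟨⟨v, j⟩, a⟩ h ⟨⟨v', j'⟩, a'⟩ h' heq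
    simp only [Finset.mem_coe, Finset.mem_product, mem_signedWords, Finset.mem_range,
      mem_pair_neg_iff, Nat.lt_succ_iff] at h h'
    obtain ⟨⟨hv, hj⟩, -⟩ := h
    obtain ⟨⟨hv', hj'⟩, ha'⟩ := h'
    obtain ⟨rfl, rfl, rfl⟩ := (insertNeg_inj (hv.notMem ha')
      (hv.notMem (by rwa [Int.natAbs_neg])) (hj.trans_eq hv.length_eq.symm)
      (hj'.trans_eq hv'.length_eq.symm)).1 heq
    rfl

theorem sum_pow_altDesc_cons_signedWords_succ {R : Type*} [CommRing R] (n : ℕ) (b : Bool) :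
    ∑ w ∈ signedWords (n + 1), (X : R[X]) ^ altDesc b (0 :: w) =
      (1 + X + (n : R[X]) * (1 + X ^ 2)) * ∑ w ∈ signedWords n, X ^ altDesc b (0 :: w) +
        (1 - X) * (1 + X ^ 2) * derivative (∑ w ∈ signedWords n, X ^ altDesc b (0 :: w)) := by
  rw [sum_signedWords_succ, derivative_sum, Finset.mul_sum, Finset.mul_sum,
    ← Finset.sum_add_distrib]
  refine Finset.sum_congr rfl fun w hw => ?_
  have hw := mem_signedWords.1 hw
  have hsum := sum_pow_altDesc_cons_insertNeg (R := R) (x := 0) b (by rw [abs_zero]; omega)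
    (fun _ => hw.abs_lt)
  rwa [hw.length_eq] at hsum

theorem sum_pow_altDesc_signedWords_succ {R : Type*} [CommRing R] {n : ℕ} (hn : n ≠ 0) (b : Bool) :
    ∑ w ∈ signedWords (n + 1), (X : R[X]) ^ altDesc b w =
      (2 * (1 + X) + ((n : R[X]) - 1) * (1 + X ^ 2)) * ∑ w ∈ signedWords n, X ^ altDesc b w +
        (1 - X) * (1 + X ^ 2) * derivative (∑ w ∈ signedWords n, X ^ altDesc b w) := by
  rw [sum_signedWords_succ, derivative_sum, Finset.mul_sum, Finset.mul_sum,
    ← Finset.sum_add_distrib]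
  refine Finset.sum_congr rfl fun w hw => ?_
  have hw := mem_signedWords.1 hw
  have hne : w ≠ [] := List.ne_nil_of_length_pos (by rw [hw.length_eq]; omega)
  have hsum := sum_pow_altDesc_insertNeg (R := R) b (fun _ => hw.abs_lt) hne
  rwa [hw.length_eq] at hsum

end SignedWords

section TypeB

variable {n : ℕ}

theorem mem_plusMinus {i : ℤ} : i ∈ plusMinus n ↔ i.natAbs ∈ Finset.Icc 1 n := by
  rw [plusMinus, Finset.mem_erase, Finset.mem_Icc, Finset.mem_Icc]
  omega

theorem signedLetter_of_mem (σ : SignedPerm n) {i : ℕ} (hi : (i : ℤ) ∈ plusMinus n) :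
    signedLetter σ i = σ.1 ⟨i, hi⟩ := dif_pos hi

theorem signedLetter_zero (σ : SignedPerm n) : signedLetter σ 0 = 0 :=
  dif_neg (by simp [mem_plusMinus])

theorem coe_apply_eq_sign_mul_signedLetter (σ : SignedPerm n) (i : plusMinus n) :
    (σ.1 i : ℤ) = (i : ℤ).sign * signedLetter σ (i : ℤ).natAbs := by
  obtain ⟨i, hi⟩ := i
  change _ = i.sign * signedLetter σ i.natAbs
  have hpos : 1 ≤ i.natAbs := (Finset.mem_Icc.1 (mem_plusMinus.1 hi)).1
  have habs : ((i.natAbs : ℕ) : ℤ) ∈ plusMinus n := by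
    rwa [mem_plusMinus, Int.natAbs_natCast, ← mem_plusMinus]
  rw [signedLetter_of_mem σ habs]
  rcases Int.natAbs_eq i with h | h
  · rw [Int.sign_eq_one_of_pos (by omega), one_mul]
    simp only [← h]
  · rw [Int.sign_eq_neg_one_of_neg (by omega), neg_one_mul]
    exact σ.2 _ _ h

/-- The word `σ(1)⋯σ(n)` of a type B permutation. -/
noncomputable def signedWord (σ : SignedPerm n) : List ℤ :=
  (List.range n).map fun i => signedLetter σ (i + 1)

theorem cons_signedWord (σ : SignedPerm n) :
    0 :: signedWord σ = (List.range (n + 1)).map (signedLetter σ) := by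
  rw [List.range_succ_eq_map, List.map_cons, List.map_map, signedLetter_zero]
  rfl

theorem altDesc_signedWord (σ : SignedPerm n) :
    altDesc false (0 :: signedWord σ) = (altDescentsB σ).card := by
  rw [cons_signedWord, altDesc_map_range, altDescentsB]
  refine congrArg _ (Finset.filter_congr fun i _ => ?_)
  by_cases hi : Even i
  · simp [hi, Nat.not_odd_iff_even.2 hi]
  · simp [hi, Nat.not_even_iff_odd.1 hi]

/-- The odd function on the integers whose values at `1, 2, …` are the letters of a word, continued
by `0`. -/
def oddExtension (w : List ℤ) (i : ℤ) : ℤ := i.sign * (0 :: w).getD i.natAbs 0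

theorem oddExtension_neg (w : List ℤ) (i : ℤ) : oddExtension w (-i) = -oddExtension w i := by
  rw [oddExtension, oddExtension, Int.sign_neg, Int.natAbs_neg, neg_mul]

theorem oddExtension_natCast_succ {w : List ℤ} {k : ℕ} (hk : k < w.length) :
    oddExtension w ((k + 1 : ℕ) : ℤ) = w[k] := by
  rw [oddExtension, Int.sign_natCast_of_ne_zero k.succ_ne_zero, one_mul, Int.natAbs_natCast,
    List.getD_cons_succ, List.getD_eq_getElem _ _ hk]

theorem oddExtension_signedWord (σ : SignedPerm n) (i : plusMinus n) :
    oddExtension (signedWord σ) i = σ.1 i := by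
  have hi := (Finset.mem_Icc.1 (mem_plusMinus.1 i.2)).2
  rw [oddExtension, cons_signedWord, coe_apply_eq_sign_mul_signedLetter,
    List.getD_eq_getElem _ _ (by simpa using Nat.lt_succ_of_le hi), List.getElem_map,
    List.getElem_range]

theorem signedWord_injective : Function.Injective (signedWord (n := n)) := fun σ τ h =>
  Subtype.ext (Equiv.ext fun i => Subtype.ext (by
    rw [← oddExtension_signedWord, ← oddExtension_signedWord, h]))

theorem isSignedWord_signedWord (σ : SignedPerm n) : IsSignedWord n (signedWord σ) := by
  refine .of_forall_exists_natAbs_eq (by simp [signedWord]) fun v hv => ?_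
  obtain ⟨i, hi⟩ := σ.1.surjective ⟨v, mem_plusMinus.2 (by rwa [Int.natAbs_natCast])⟩
  have hi_bounds := Finset.mem_Icc.1 (mem_plusMinus.1 i.2)
  have hne : (i : ℤ) ≠ 0 := Int.natAbs_ne_zero.1 (by omega)
  refine ⟨signedLetter σ (i : ℤ).natAbs, List.mem_map.2 ⟨(i : ℤ).natAbs - 1, ?_, ?_⟩, ?_⟩
  · rw [List.mem_range]
    omega
  · rw [Nat.sub_add_cancel hi_bounds.1]
  · have hv := congrArg (fun j : plusMinus n => (j : ℤ).natAbs) hi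
    simpa [coe_apply_eq_sign_mul_signedLetter, Int.natAbs_mul, Int.natAbs_sign_of_ne_zero hne]
      using hv

namespace IsSignedWord

variable {w : List ℤ}

theorem oddExtension_mem (hw : IsSignedWord n w) {i : ℤ} (hi : i ∈ plusMinus n) :
    oddExtension w i ∈ plusMinus n := by
  have hi := Finset.mem_Icc.1 (mem_plusMinus.1 hi)
  obtain ⟨k, hk⟩ := Nat.exists_eq_add_of_le' hi.1
  have hkw : k < w.length := by
    rw [hw.length_eq]
    omega
  have hlast : w[k].natAbs ∈ Finset.Icc 1 n := hw.natAbs_mem_Icc (List.getElem_mem hkw)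
  rw [mem_plusMinus]
  rcases Int.natAbs_eq i with h | h <;> rw [h, hk]
  · rwa [oddExtension_natCast_succ hkw]
  · rwa [oddExtension_neg, Int.natAbs_neg, oddExtension_natCast_succ hkw]

theorem exists_oddExtension_eq (hw : IsSignedWord n w) {y : ℤ} (hy : y ∈ plusMinus n) :
    ∃ i ∈ plusMinus n, oddExtension w i = y := by
  obtain ⟨z, hz, hzy⟩ := hw.exists_natAbs_eq (mem_plusMinus.1 hy)
  obtain ⟨k, hk, rfl⟩ := List.getElem_of_mem hz
  have hmem : ((k + 1 : ℕ) : ℤ) ∈ plusMinus n := by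
    rw [mem_plusMinus, Int.natAbs_natCast, Finset.mem_Icc, ← hw.length_eq]
    omega
  rcases Int.natAbs_eq_natAbs_iff.1 hzy with h | h
  · exact ⟨_, hmem, by rw [oddExtension_natCast_succ hk, h]⟩
  · refine ⟨-((k + 1 : ℕ) : ℤ), ?_, ?_⟩
    · rwa [mem_plusMinus, Int.natAbs_neg, ← mem_plusMinus]
    · rw [oddExtension_neg, oddExtension_natCast_succ hk, h, neg_neg]

theorem exists_signedWord_eq (hw : IsSignedWord n w) : ∃ σ : SignedPerm n, signedWord σ = w := by
  have hsurj : Function.Surjective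
      fun i : plusMinus n => (⟨oddExtension w i, hw.oddExtension_mem i.2⟩ : plusMinus n) :=
    fun y => by
      obtain ⟨i, hi, h⟩ := hw.exists_oddExtension_eq y.2
      exact ⟨⟨i, hi⟩, Subtype.ext h⟩
  have hbij := Finite.surjective_iff_bijective.1 hsurj
  refine ⟨⟨Equiv.ofBijective _ hbij, fun i j h => ?_⟩, ?_⟩
  · simp only [Equiv.ofBijective_apply, h, oddExtension_neg]
  · refine List.ext_getElem (by simp [signedWord, hw.length_eq]) fun k _ hk => ?_
    have hmem : ((k + 1 : ℕ) : ℤ) ∈ plusMinus n := by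
      rw [mem_plusMinus, Int.natAbs_natCast, Finset.mem_Icc, ← hw.length_eq]
      omega
    simp only [signedWord, List.getElem_map, List.getElem_range]
    rw [signedLetter_of_mem _ hmem]
    exact oddExtension_natCast_succ hk

end IsSignedWord

theorem altEulerianB_eq_sum_signedWords (n : ℕ) :
    altEulerianB n = ∑ w ∈ signedWords n, X ^ altDesc false (0 :: w) := by
  refine Finset.sum_bij (fun σ _ => signedWord σ)
    (fun σ _ => mem_signedWords.2 (isSignedWord_signedWord σ))
    (fun σ _ τ _ h => signedWord_injective h) (fun w hw => ?_)
    (fun σ _ => by rw [altDesc_signedWord])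
  obtain ⟨σ, hσ⟩ := (mem_signedWords.1 hw).exists_signedWord_eq
  exact ⟨σ, Finset.mem_univ _, hσ⟩

theorem altEulerianB_zero : altEulerianB 0 = 1 := by
  simp [altEulerianB_eq_sum_signedWords, signedWords]

theorem altEulerianB_succ (n : ℕ) :
    altEulerianB (n + 1) = (1 + X + (n : ℝ[X]) * (1 + X ^ 2)) * altEulerianB n +
      (1 - X) * (1 + X ^ 2) * derivative (altEulerianB n) := by
  simp only [altEulerianB_eq_sum_signedWords]
  exact sum_pow_altDesc_cons_signedWords_succ n false

end TypeB

section TypeA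

theorem altDesc_ofFn {n : ℕ} (σ : Equiv.Perm (Fin n)) :
    altDesc true (List.ofFn σ) = (altDescents σ).card := by
  cases n with
  | zero => simp [altDesc, altDescents]
  | succ n =>
    have hmono : StrictMono fun i : Fin (n + 1) => (i : ℕ) + 1 := fun i j h =>
      Nat.succ_lt_succ h
    have hword : (List.ofFn σ).map (fun i : Fin (n + 1) => (i : ℕ) + 1) =
        (List.range (n + 1)).map fun i => letter σ (i + 1) := by
      refine List.ext_getElem (by simp) fun i _ hi => ?_
      have hi : i ≤ n := by simpa [Nat.lt_succ_iff] using hi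
      simp [letter, hi, -List.ofFn_succ]
    rw [← altDesc_map_of_strictMono hmono, hword, altDesc_map_range, altDescents,
      Finset.card_filter, Finset.card_filter, Finset.sum_Ico_eq_sum_range]
    refine Finset.sum_congr rfl fun i _ => ?_
    rw [add_comm 1 i]
    by_cases hi : Even i
    · simp [hi, Nat.even_add_one]
    · simp [hi, Nat.odd_add_one, Nat.even_add_one]

section Arrangements

variable {α : Type*} [LinearOrder α]

/-- The arrangement of the elements of `s` as a word whose pattern is `σ`: its `i`-th letter is the
`σ i`-th smallest element of `s`. -/
def arrangement (s : Finset α) (σ : Equiv.Perm (Fin s.card)) : List α :=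
  (List.ofFn σ).map (s.orderEmbOfFin rfl)

theorem altDesc_arrangement (s : Finset α) (σ : Equiv.Perm (Fin s.card)) :
    altDesc true (arrangement s σ) = (altDescents σ).card := by
  rw [arrangement, altDesc_map_of_strictMono (s.orderEmbOfFin rfl).strictMono, altDesc_ofFn]

theorem coe_arrangement (s : Finset α) (σ : Equiv.Perm (Fin s.card)) :
    (arrangement s σ : Multiset α) = s.val := by
  have hσ : (List.ofFn σ : Multiset (Fin s.card)) = (Finset.univ : Finset (Fin s.card)).val := by
    rw [← Fin.univ_val_map]
    exact congrArg Finset.val (Finset.map_univ_equiv σ)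
  rw [arrangement, ← Multiset.map_coe, hσ]
  exact congrArg Finset.val (s.map_orderEmbOfFin_univ rfl)

theorem arrangement_injective (s : Finset α) : Function.Injective (arrangement s) := fun _ _ h =>
  DFunLike.coe_injective (List.ofFn_injective
    (List.map_injective_iff.2 (s.orderEmbOfFin rfl).injective h))

theorem exists_arrangement_eq {s : Finset α} {w : List α} (hw : (w : Multiset α) = s.val) :
    ∃ σ, arrangement s σ = w := by
  have hlen : w.length = s.card := congrArg Multiset.card hw
  have hnodup : w.Nodup := by
    rw [← Multiset.coe_nodup, hw]
    exact s.nodup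
  have hmem (i : Fin s.card) : w[i] ∈ s := by
    rw [← Finset.mem_val, ← hw, Multiset.mem_coe]
    exact List.getElem_mem _
  have hinj : Function.Injective fun i : Fin s.card =>
      (s.orderIsoOfFin rfl).symm ⟨w[i], hmem i⟩ := fun i j h =>
    Fin.ext ((hnodup.getElem_inj_iff).1
      (congrArg Subtype.val ((s.orderIsoOfFin rfl).symm.injective h)))
  refine ⟨Equiv.ofBijective _ (Finite.injective_iff_bijective.1 hinj), ?_⟩
  refine List.ext_getElem (by simp [arrangement, hlen]) fun i _ hi => ?_
  simp [arrangement, ← Finset.coe_orderIsoOfFin_apply]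

theorem sum_pow_altDesc_eq_altEulerianA {s : Finset α} {W : Finset (List α)}
    (hW : ∀ w, w ∈ W ↔ (w : Multiset α) = s.val) :
    ∑ w ∈ W, (X : ℝ[X]) ^ altDesc true w = altEulerianA s.card := by
  symm
  refine Finset.sum_bij (fun σ _ => arrangement s σ)
    (fun σ _ => (hW _).2 (coe_arrangement s σ))
    (fun σ _ τ _ h => arrangement_injective s h) (fun w hw => ?_)
    (fun σ _ => by rw [altDesc_arrangement])
  obtain ⟨σ, hσ⟩ := exists_arrangement_eq ((hW w).1 hw)
  exact ⟨σ, Finset.mem_univ _, hσ⟩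

end Arrangements

section Signs

variable {n : ℕ} {S : Finset ℕ} {w : List ℤ}

/-- The natural number `v` with the sign prescribed by `S`, the set of values that are to be
negated. -/
def signWith (S : Finset ℕ) (v : ℕ) : ℤ := if v ∈ S then -v else v

theorem natAbs_signWith (S : Finset ℕ) (v : ℕ) : (signWith S v).natAbs = v := by
  rw [signWith]
  split_ifs <;> simp

theorem signWith_eq_neg_iff {v : ℕ} (hv : v ≠ 0) : signWith S v = -v ↔ v ∈ S := by
  rw [signWith]
  split_ifs with h <;> simp only [h, iff_false]
  omega

/-- The letters of the signed words of length `n` that have `S` as the set of absolute values of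
their negative letters. -/
def signedLetters (n : ℕ) (S : Finset ℕ) : Finset ℤ :=
  (Finset.Icc 1 n).map ⟨signWith S, Function.LeftInverse.injective (natAbs_signWith S)⟩

/-- The absolute values of the negative letters of a signed word of length `n`. -/
def negatives (n : ℕ) (w : List ℤ) : Finset ℕ := {v ∈ Finset.Icc 1 n | -(v : ℤ) ∈ w}

theorem IsSignedWord.natAbs_mem_negatives_iff (hw : IsSignedWord n w) {y : ℤ} (hy : y ∈ w) :
    y.natAbs ∈ negatives n w ↔ y < 0 := by
  have hyn := hw.natAbs_mem_Icc hy
  rw [negatives, Finset.mem_filter, and_iff_right hyn]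
  constructor
  · intro hneg
    have heq : y = -(y.natAbs : ℤ) :=
      List.inj_on_of_nodup_map hw.nodup_map_natAbs hy hneg (by omega)
    rw [Finset.mem_Icc] at hyn
    omega
  · intro hlt
    rwa [Int.ofNat_natAbs_of_nonpos hlt.le, neg_neg]

theorem IsSignedWord.signWith_negatives (hw : IsSignedWord n w) {y : ℤ} (hy : y ∈ w) :
    signWith (negatives n w) y.natAbs = y := by
  simp only [signWith, hw.natAbs_mem_negatives_iff hy]
  split_ifs <;> omega

theorem isSignedWord_and_negatives_eq_iff (hS : S ⊆ Finset.Icc 1 n) :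
    IsSignedWord n w ∧ negatives n w = S ↔ (w : Multiset ℤ) = (signedLetters n S).val := by
  rw [signedLetters, Finset.map_val, Function.Embedding.coeFn_mk]
  constructor
  · rintro ⟨hw, rfl⟩
    rw [← hw, Multiset.map_map]
    exact (Multiset.map_id' _).symm.trans
      (Multiset.map_congr rfl fun y hy => (hw.signWith_negatives hy).symm)
  · intro hw
    have hmem (v : ℕ) (hv : v ∈ Finset.Icc 1 n) : -(v : ℤ) ∈ w ↔ v ∈ S := by
      rw [← signWith_eq_neg_iff (Nat.one_le_iff_ne_zero.1 (Finset.mem_Icc.1 hv).1),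
        ← Multiset.mem_coe, hw, Multiset.mem_map]
      constructor
      · rintro ⟨u, -, hu⟩
        have huv := natAbs_signWith S u
        rw [hu, Int.natAbs_neg, Int.natAbs_natCast] at huv
        rwa [← huv] at hu
      · exact fun h => ⟨v, hv, h⟩
    refine ⟨?_, ?_⟩
    · have hid : Int.natAbs ∘ signWith S = id := funext (natAbs_signWith S)
      rw [IsSignedWord, hw, Multiset.map_map, hid, Multiset.map_id]
    · rw [negatives, Finset.filter_congr hmem, Finset.filter_mem_eq_inter,
        Finset.inter_eq_right.2 hS]

theorem sum_signedWords_pow_altDesc (n : ℕ) :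
    ∑ w ∈ signedWords n, (X : ℝ[X]) ^ altDesc true w = 2 ^ n * altEulerianA n := by
  have hfiber : ∀ S ∈ (Finset.Icc 1 n).powerset,
      ∑ w ∈ signedWords n with negatives n w = S, (X : ℝ[X]) ^ altDesc true w =
        altEulerianA n := fun S hS => by
    rw [sum_pow_altDesc_eq_altEulerianA (s := signedLetters n S) fun w => by
      rw [Finset.mem_filter, mem_signedWords,
        isSignedWord_and_negatives_eq_iff (Finset.mem_powerset.1 hS)]]
    simp [signedLetters]
  have hmaps : ∀ w ∈ signedWords n, negatives n w ∈ (Finset.Icc 1 n).powerset := fun w _ =>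
    Finset.mem_powerset.2 (Finset.filter_subset _ _)
  rw [← Finset.sum_fiberwise_of_maps_to hmaps, Finset.sum_congr rfl hfiber]
  simp

end Signs

theorem altEulerianA_one : altEulerianA 1 = 1 := by
  simp [altEulerianA, altDescents]

theorem two_mul_altEulerianA_succ {n : ℕ} (hn : n ≠ 0) :
    2 * altEulerianA (n + 1) = (2 * (1 + X) + ((n : ℝ[X]) - 1) * (1 + X ^ 2)) * altEulerianA n +
      (1 - X) * (1 + X ^ 2) * derivative (altEulerianA n) := by
  have hrec := sum_pow_altDesc_signedWords_succ (R := ℝ) hn true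
  have htwo : derivative (2 ^ n : ℝ[X]) = 0 := by simp [derivative_pow]
  rw [sum_signedWords_pow_altDesc, sum_signedWords_pow_altDesc, derivative_mul, htwo] at hrec
  have hpow : (2 : ℝ[X]) ^ n ≠ 0 := pow_ne_zero n two_ne_zero
  refine mul_left_cancel₀ hpow ?_
  linear_combination hrec

end TypeA

section Moebius

theorem exists_derivation_extending {R A B M : Type*} [CommRing R] [CommRing A] [CommRing B]
    [Algebra R A] [Algebra R B] [Algebra A B] [IsScalarTower R A B] [Algebra.FormallyEtale A B]
    [AddCommGroup M] [Module R M] [Module A M] [Module B M] [IsScalarTower R A M]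
    [IsScalarTower R B M] [IsScalarTower A B M] (d : Derivation R A M) :
    ∃ D : Derivation R B M, ∀ a, D (algebraMap A B a) = d a :=
  ⟨((d.liftKaehlerDifferential.liftBaseChange B) ∘ₗ
      (KaehlerDifferential.tensorKaehlerEquivOfFormallyEtale R A B).symm.toLinearMap).compDer
      (KaehlerDifferential.D R B), fun a => by
    simp [KaehlerDifferential.tensorKaehlerEquivOfFormallyEtale_symm_D_algebraMap]⟩

theorem exists_derivation_ratFunc_X_eq_one (k : Type*) [Field k] :
    ∃ D : Derivation k (RatFunc k) (RatFunc k), D RatFunc.X = 1 := by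
  have : Algebra.FormallyEtale k[X] (RatFunc k) := .of_isLocalization (nonZeroDivisors k[X])
  obtain ⟨D, hD⟩ := exists_derivation_extending (B := RatFunc k) (mkDerivation k (1 : RatFunc k))
  exact ⟨D, by rw [← RatFunc.algebraMap_X, hD, mkDerivation_X]⟩

theorem ratFunc_one_sub_X_ne_zero (k : Type*) [Field k] : (1 - RatFunc.X : RatFunc k) ≠ 0 := by
  rw [sub_ne_zero, ← RatFunc.algebraMap_X, ← map_one (algebraMap k[X] (RatFunc k)), Ne,
    (RatFunc.algebraMap_injective k).eq_iff]
  exact X_ne_C 1 ∘ Eq.symm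

variable {k K : Type*} [Field k] [Field K] [Algebra k K] {x : K}

theorem derivation_moebius (D : Derivation k K K) (hD : D x = 1) (hx : 1 - x ≠ 0) :
    D ((1 + x) / (1 - x)) = 2 / (1 - x) ^ 2 := by
  simp only [Derivation.leibniz_div, map_add, map_sub, Derivation.map_one_eq_zero, hD, smul_eq_mul]
  field_simp
  ring

theorem aeval_derivative_moebius (D : Derivation k K K) (hD : D x = 1) (hx : 1 - x ≠ 0) (n : ℕ)
    {F Q : k[X]} (hF : aeval x F = (1 - x) ^ n * aeval ((1 + x) / (1 - x)) Q) :
    aeval x ((n : k[X]) * (1 + X ^ 2) * F + (1 - X) * (1 + X ^ 2) * derivative F) =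
      (1 - x) ^ (n + 1) * aeval ((1 + x) / (1 - x)) ((1 + X ^ 2) * derivative Q) := by
  have hF' := congrArg D hF
  rw [D.map_aeval, hD, D.leibniz, D.leibniz_pow, D.map_aeval, derivation_moebius D hD hx,
    map_sub, D.map_one_eq_zero, hD] at hF'
  simp only [smul_eq_mul, nsmul_eq_mul, mul_one] at hF'
  simp only [map_add, map_mul, map_sub, map_pow, map_one, map_natCast, aeval_X, hF, hF']
  cases n with
  | zero =>
    simp only [Nat.cast_zero]
    field_simp
    ring
  | succ n =>
    simp only [Nat.add_sub_cancel, Nat.cast_succ]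
    field_simp
    ring

end Moebius

section DerivativePolynomials

theorem isTanDerivPoly_tanDerivPoly (n : ℕ) : IsTanDerivPoly n (tanDerivPoly n) :=
  (existsUnique_tanDerivPoly n).choose_spec.1

theorem isSecDerivPoly_secDerivPoly (n : ℕ) : IsSecDerivPoly n (secDerivPoly n) :=
  (existsUnique_secDerivPoly n).choose_spec.1

theorem tanDerivPoly_zero : tanDerivPoly 0 = X :=
  (existsUnique_tanDerivPoly 0).unique (isTanDerivPoly_tanDerivPoly 0) fun x _ => by simp

theorem tanDerivPoly_succ (n : ℕ) :
    tanDerivPoly (n + 1) = (1 + X ^ 2) * derivative (tanDerivPoly n) :=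
  (existsUnique_tanDerivPoly (n + 1)).unique (isTanDerivPoly_tanDerivPoly _)
    (isTanDerivPoly_tanDerivPoly n).succ

theorem secDerivPoly_zero : secDerivPoly 0 = 1 :=
  (existsUnique_secDerivPoly 0).unique (isSecDerivPoly_secDerivPoly 0) fun x _ => by simp

theorem secDerivPoly_succ (n : ℕ) :
    secDerivPoly (n + 1) = X * secDerivPoly n + (1 + X ^ 2) * derivative (secDerivPoly n) :=
  (existsUnique_secDerivPoly (n + 1)).unique (isSecDerivPoly_secDerivPoly _)
    (isSecDerivPoly_secDerivPoly n).succ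

end DerivativePolynomials

section Identities

variable {K : Type*} [Field K] [Algebra ℝ K] {x : K}

theorem aeval_altEulerianB (D : Derivation ℝ K K) (hD : D x = 1) (hx : 1 - x ≠ 0) (n : ℕ) :
    aeval x (altEulerianB n) = (1 - x) ^ n * aeval ((1 + x) / (1 - x)) (secDerivPoly n) := by
  induction n with
  | zero => simp [altEulerianB_zero, secDerivPoly_zero]
  | succ n ih =>
    have hderiv := aeval_derivative_moebius D hD hx n ih
    calc aeval x (altEulerianB (n + 1))
        = (1 + x) * aeval x (altEulerianB n) + aeval x ((n : ℝ[X]) * (1 + X ^ 2) * altEulerianB n +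
            (1 - X) * (1 + X ^ 2) * derivative (altEulerianB n)) := by
          rw [altEulerianB_succ]
          simp only [map_add, map_mul, map_one, aeval_X]
          ring
      _ = _ := by
          rw [hderiv, ih, secDerivPoly_succ, map_add (aeval _), map_mul (aeval _) X, aeval_X]
          field_simp
          ring

theorem two_pow_mul_altEulerianA_succ {n : ℕ} (hn : n ≠ 0) :
    2 ^ (n + 1) * (1 + X ^ 2) * altEulerianA (n + 1) =
      ((n + 1 : ℕ) : ℝ[X]) * (1 + X ^ 2) * (2 ^ n * (1 + X ^ 2) * altEulerianA n) +
        (1 - X) * (1 + X ^ 2) * derivative (2 ^ n * (1 + X ^ 2) * altEulerianA n) := by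
  have hderiv : derivative (2 ^ n * (1 + X ^ 2) * altEulerianA n) =
      2 ^ n * (2 * X * altEulerianA n + (1 + X ^ 2) * derivative (altEulerianA n)) := by
    simp only [derivative_mul, derivative_pow, derivative_add, derivative_one, derivative_ofNat,
      derivative_X, map_natCast]
    push_cast
    ring
  rw [hderiv]
  push_cast
  linear_combination 2 ^ n * (1 + X ^ 2) * two_mul_altEulerianA_succ hn

theorem aeval_altEulerianA (D : Derivation ℝ K K) (hD : D x = 1) (hx : 1 - x ≠ 0) {n : ℕ}
    (hn : 1 ≤ n) :
    aeval x (2 ^ n * (1 + X ^ 2) * altEulerianA n) =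
      (1 - x) ^ (n + 1) * aeval ((1 + x) / (1 - x)) (tanDerivPoly n) := by
  induction n, hn using Nat.le_induction with
  | base =>
    simp only [altEulerianA_one, tanDerivPoly_succ, tanDerivPoly_zero, derivative_X, map_mul,
      map_pow, map_add, map_one, map_ofNat, aeval_X]
    field_simp
    ring
  | succ n hn ih =>
    rw [tanDerivPoly_succ, ← aeval_derivative_moebius D hD hx (n + 1) ih,
      two_pow_mul_altEulerianA_succ (Nat.one_le_iff_ne_zero.1 hn)]

end Identities

end AltDescent

theorem theorem2 (n : ℕ) :
    (1 ≤ n →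
      (2 : RatFunc ℝ) ^ n * (1 + RatFunc.X ^ 2) *
          Polynomial.aeval (RatFunc.X : RatFunc ℝ) (AltDescent.altEulerianA n) =
        (1 - RatFunc.X) ^ (n + 1) *
          Polynomial.aeval ((1 + RatFunc.X) / (1 - RatFunc.X) : RatFunc ℝ)
            (AltDescent.tanDerivPoly n)) ∧
    Polynomial.aeval (RatFunc.X : RatFunc ℝ) (AltDescent.altEulerianB n) =
      (1 - RatFunc.X) ^ n *
        Polynomial.aeval ((1 + RatFunc.X) / (1 - RatFunc.X) : RatFunc ℝ)
          (AltDescent.secDerivPoly n) := by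
  obtain ⟨D, hD⟩ := AltDescent.exists_derivation_ratFunc_X_eq_one ℝ
  have hX := AltDescent.ratFunc_one_sub_X_ne_zero ℝ
  refine ⟨fun hn => ?_, AltDescent.aeval_altEulerianB D hD hX n⟩
  rw [← AltDescent.aeval_altEulerianA D hD hX hn]
  simp only [map_mul, map_pow, map_add, map_one, map_ofNat, aeval_X]
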